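/- Let $X$ be a countable set of variables and let $Fm$ be the set of formulae over $X$ in the language $\langle\neg,\lor,\to\rangle$. Abbreviate $\phi\land\psi:=\neg(\neg\phi\lor\neg\psi)$, $\phi\supset\psi:=\neg\phi\lor\psi$, $\phi\equiv\psi:=(\phi\supset\psi)\land(\psi\supset\phi)$, $\tau_\phi:=\phi\lor\neg\phi$. Let $L\in\{\mathbf D,\mathbf{dD},\mathbf{Eq}\}$ (dependence, dual dependence, equality of content). The abbreviation $\phi\prec\psi$ ("the content of $\phi$ is included in that of $\psi$") stands for $\psi\to\tau_\phi$ if $L=\mathbf D$, for $\phi\to\tau_\psi$ if $L=\mathbf{dD}$, and for $(\phi\lor\psi)\to\tau_\psi$ if $L=\mathbf{Eq}$. **Calculus.** $gL$ is the Hilbert calculus on $Fm$ whose only rule is modus ponens $\phi,\ \phi\supset\psi\vdash\psi$ and whose axiom schemata are - (A0) $(\phi\lor\psi)\equiv(\neg\phi\supset\psi)$; (A1) $\phi\supset(\psi\supset\phi)$; (A2) $(\phi\supset(\psi\supset\chi))\supset((\phi\supset\psi)\supset(\phi\supset\chi))$; (A3) $(\neg\phi\supset\neg\psi)\supset(\psi\supset\phi)$;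 - (A4$^L$) $(\phi\to\psi)\equiv((\phi\supset\psi)\land\kappa)$, where $\kappa$ is $\psi\prec\phi$ for $\mathbf D$, $\phi\prec\psi$ for $\mathbf{dD}$, and $(\phi\prec\psi)\land(\psi\prec\phi)$ for $\mathbf{Eq}$; - (A5) $((\phi\to\psi)\prec(\phi\lor\psi))\land((\phi\lor\psi)\prec(\phi\to\psi))$; - (O1) $\phi\prec\phi$; (O2) $((\phi\prec\psi)\land(\psi\prec\chi))\supset(\phi\prec\chi)$; (O3) $(\phi\prec\psi)\supset((\phi\lor\psi)\prec\psi)$; (O4) $((\phi\prec\psi)\equiv(\phi\prec\neg\psi))\land((\phi\prec\psi)\equiv(\neg\phi\prec\psi))$; - (C1) $(\phi\prec(\phi\lor\psi))\land(\psi\prec(\phi\lor\psi))$; (C2) $((\phi\prec\chi)\land(\psi\prec\chi))\supset((\phi\lor\psi)\prec\chi)$; (C3) $((\phi\prec\chi)\land(\chi\prec\phi)\land(\psi\prec\zeta)\land(\zeta\prec\psi))\supset((\phi\to\psi)\prec(\chi\to\zeta))$. The calculus $g\mathbf D$ is also called $\mathbf{DAI}$. **Generalized models.** A $gL$-model is $\langle\mathbf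 B,\langle S,\oplus\rangle,N,v,s\rangle$ where $\mathbf B$ is a Boolean algebra; $\langle S,\oplus\rangle$ is a join-semilattice with order $\le$; $N:Fm\to Fm_{\langle\oplus\rangle}$ is the translation that fixes variables, deletes negations and turns $\lor$ and $\to$ into $\oplus$; $s:Fm_{\langle\oplus\rangle}\to S$ is a homomorphism; and $v:Fm\to B$ is a homomorphism with respect to $\neg,\lor$ such that $v(\phi\to\psi)=v(\neg\phi\lor\psi)$ if $C_L(s(N(\phi)),s(N(\psi)))$ holds and $v(\phi\to\psi)=0$ otherwise. Here $C_L(a,b)$ is $b\le a$ for $\mathbf D$, $a\le b$ for $\mathbf{dD}$, and $a=b$ for $\mathbf{Eq}$. Write $\Gamma\vDash_{gL}\phi$ if in every $gL$-model in which $v(\gamma)=1$ for all $\gamma\in\Gamma$ also $v(\phi)=1$. **Epstein's logics.** Let $Fm^\land$ be the set of formulae over $X$ in the language $\langle\neg,\land,\lor,\to\rangle$. An Epstein $L$-model is a pair $\langle v,s\rangle$, where, for some countable set $U$, $s:Fm^\land\to\mathscr P(U)$ satisfies $s(\phi)=\bigcup\{s(p): p\in Var(\phi)\}$, and $v:Fm^\land\to\{0,1\}$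 is Boolean with respect to $\neg,\land,\lor$, with $v(\phi\to\psi)=v(\neg\phi\lor\psi)$ if $C_L(s(\phi),s(\psi))$ holds for the order $\subseteq$, and $v(\phi\to\psi)=0$ otherwise. Epstein's logic $L$ is the consequence relation of this class of models: $\Gamma\vdash_L\phi$ iff every Epstein $L$-model with $v(\gamma)=1$ for all $\gamma\in\Gamma$ has $v(\phi)=1$. **Theorem.** For each $L\in\{\mathbf D,\mathbf{dD},\mathbf{Eq}\}$: 1. $gL$ is (strongly) sound and complete with respect to the class of $gL$-models: for all $\Gamma\subseteq Fm$ and $\phi\in Fm$, $\Gamma\vdash_{gL}\phi$ iff $\Gamma\vDash_{gL}\phi$. 2. $L$ and $gL$ are the same logic: for all $\Gamma\subseteq Fm$ and $\phi\in Fm$, $\Gamma\vdash_L\phi$ iff $\Gamma\vdash_{gL}\phi$; moreover for all $\Gamma\subseteq Fm^\land$ and $\phi\in Fm^\land$, $\Gamma\vdash_L\phi$ iff $\Gamma^*\vdash_{gL}\phi^*$, where $^*$ replaces each conjunction by its definition $\neg(\neg\phi\lor\neg\psi)$. -/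

import Mathlib

universe u v w

namespace EpsteinLogic

/-- The three dependence logics: dependence `D`, dual dependence `dD`, equality of content `Eq`. -/
inductive Dep where
  | D
  | dD
  | Eq

/-- Formulae of the language `⟨¬, ∨, →⟩` over a set `X` of variables. -/
inductive Fm (X : Type w) where
  | var (p : X)
  | neg (φ : Fm X)
  | or (φ ψ : Fm X)
  | imp (φ ψ : Fm X)

namespace Fm

variable {X : Type w}

/-- Conjunction `φ ∧ ψ := ¬(¬φ ∨ ¬ψ)`. -/
def and (φ ψ : Fm X) : Fm X := neg (or (neg φ) (neg ψ))

/-- Material implication `φ ⊃ ψ := ¬φ ∨ ψ`. -/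
def mat (φ ψ : Fm X) : Fm X := or (neg φ) ψ

/-- Material equivalence `φ ≡ ψ := (φ ⊃ ψ) ∧ (ψ ⊃ φ)`. -/
def iff (φ ψ : Fm X) : Fm X := (φ.mat ψ).and (ψ.mat φ)

/-- `τ_φ := φ ∨ ¬φ`. -/
def taut (φ : Fm X) : Fm X := or φ (neg φ)

/-- The abbreviation `φ ≺ ψ`, "the content of `φ` is included in that of `ψ`". Since the content
condition attached to `→` depends on the logic, so does the defining formula:
`ψ → (φ ∨ ¬φ)` for `D`, `φ → (ψ ∨ ¬ψ)` for `dD` and `(φ ∨ ψ) → (ψ ∨ ¬ψ)` for `Eq`. -/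
def prec : Dep → Fm X → Fm X → Fm X
  | .D, φ, ψ => imp ψ φ.taut
  | .dD, φ, ψ => imp φ ψ.taut
  | .Eq, φ, ψ => imp (or φ ψ) ψ.taut

end Fm

/-! ### The Hilbert calculi -/

/-- The content part of the axiom that defines `→`: `ψ ≺ φ` for `D`, `φ ≺ ψ` for `dD`,
`(φ ≺ ψ) ∧ (ψ ≺ φ)` for `Eq`. -/
def contentFm {X : Type w} : Dep → Fm X → Fm X → Fm X
  | .D, φ, ψ => ψ.prec .D φ
  | .dD, φ, ψ => φ.prec .dD ψ
  | .Eq, φ, ψ => (φ.prec .Eq ψ).and (ψ.prec .Eq φ)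

/-- The axioms of the calculus `gL`. Disjunction is primitive and `⊃` is defined from it, so
`A1`-`A3` are completed to an axiomatization of classical logic by the schema `A0`. -/
inductive Ax {X : Type w} (L : Dep) : Fm X → Prop
  | A0 (φ ψ : Fm X) : Ax L ((φ.or ψ).iff (φ.neg.mat ψ))
  | A1 (φ ψ : Fm X) : Ax L (φ.mat (ψ.mat φ))
  | A2 (φ ψ χ : Fm X) : Ax L ((φ.mat (ψ.mat χ)).mat ((φ.mat ψ).mat (φ.mat χ)))
  | A3 (φ ψ : Fm X) : Ax L ((φ.neg.mat ψ.neg).mat (ψ.mat φ))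
  | A4 (φ ψ : Fm X) : Ax L ((φ.imp ψ).iff ((φ.mat ψ).and (contentFm L φ ψ)))
  | A5 (φ ψ : Fm X) : Ax L (((φ.imp ψ).prec L (φ.or ψ)).and ((φ.or ψ).prec L (φ.imp ψ)))
  | O1 (φ : Fm X) : Ax L (φ.prec L φ)
  | O2 (φ ψ χ : Fm X) : Ax L (((φ.prec L ψ).and (ψ.prec L χ)).mat (φ.prec L χ))
  | O3 (φ ψ : Fm X) : Ax L ((φ.prec L ψ).mat ((φ.or ψ).prec L ψ))
  | O4 (φ ψ : Fm X) : Ax L (((φ.prec L ψ).iff (φ.prec L ψ.neg)).and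
      ((φ.prec L ψ).iff (φ.neg.prec L ψ)))
  | C1 (φ ψ : Fm X) : Ax L ((φ.prec L (φ.or ψ)).and (ψ.prec L (φ.or ψ)))
  | C2 (φ ψ χ : Fm X) : Ax L (((φ.prec L χ).and (ψ.prec L χ)).mat ((φ.or ψ).prec L χ))
  | C3 (φ ψ χ ζ : Fm X) : Ax L
      (((((φ.prec L χ).and (χ.prec L φ)).and (ψ.prec L ζ)).and (ζ.prec L ψ)).mat
        ((φ.imp ψ).prec L (χ.imp ζ)))

/-- Derivability `Γ ⊢ φ` in the calculus `gL`; the only rule is modus ponens for `⊃`. -/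
inductive Derives {X : Type w} (L : Dep) (Γ : Set (Fm X)) : Fm X → Prop
  | hyp {φ : Fm X} : φ ∈ Γ → Derives L Γ φ
  | ax {φ : Fm X} : Ax L φ → Derives L Γ φ
  | mp {φ ψ : Fm X} : Derives L Γ φ → Derives L Γ (φ.mat ψ) → Derives L Γ ψ

/-! ### Generalized models -/

/-- The condition `C_L` on the contents `a` of the antecedent and `b` of the consequent. -/
def Dep.Cond (L : Dep) {S : Type v} [LE S] (a b : S) : Prop :=
  match L with
  | .D => b ≤ a
  | .dD => a ≤ b
  | .Eq => a = b

/-- Terms of the language `⟨⊕⟩` over the variables `X`. -/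
inductive CTerm (X : Type w) where
  | var (p : X)
  | join (a b : CTerm X)

/-- The translation `N` deletes negations and turns both binary connectives into joins. -/
def N {X : Type w} : Fm X → CTerm X
  | .var p => .var p
  | .neg φ => N φ
  | .or φ ψ => .join (N φ) (N ψ)
  | .imp φ ψ => .join (N φ) (N ψ)

/-- A `gL`-model with algebra of truth values `B` (a Boolean algebra) and algebra of contents `S`
(a join-semilattice). -/
structure GModel (L : Dep) (X : Type w) (B : Type u) [BooleanAlgebra B]
    (S : Type v) [SemilatticeSup S] where
  s : CTerm X → S
  s_join : ∀ a b, s (.join a b) = s a ⊔ s b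
  v : Fm X → B
  v_neg : ∀ φ, v φ.neg = (v φ)ᶜ
  v_or : ∀ φ ψ, v (φ.or ψ) = v φ ⊔ v ψ
  v_imp : ∀ φ ψ, L.Cond (s (N φ)) (s (N ψ)) → v (φ.imp ψ) = v (φ.neg.or ψ)
  v_imp_of_not : ∀ φ ψ, ¬ L.Cond (s (N φ)) (s (N ψ)) → v (φ.imp ψ) = ⊥

/-- Consequence over the class of all `gL`-models. -/
def GEntails {X : Type w} (L : Dep) (Γ : Set (Fm X)) (φ : Fm X) : Prop :=
  ∀ (B : Type u) [BooleanAlgebra B] (S : Type v) [SemilatticeSup S] (M : GModel L X B S),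
    (∀ γ ∈ Γ, M.v γ = ⊤) → M.v φ = ⊤

/-! ### Epstein's dependence logics -/

/-- Formulae of Epstein's language `⟨¬, ∧, ∨, →⟩`. -/
inductive EFm (X : Type w) where
  | var (p : X)
  | neg (φ : EFm X)
  | and (φ ψ : EFm X)
  | or (φ ψ : EFm X)
  | imp (φ ψ : EFm X)

/-- The variables of a formula. -/
def EFm.vars {X : Type w} : EFm X → Set X
  | .var p => {p}
  | .neg φ => φ.vars
  | .and φ ψ => φ.vars ∪ ψ.vars
  | .or φ ψ => φ.vars ∪ ψ.vars
  | .imp φ ψ => φ.vars ∪ ψ.vars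

/-- A (dual) dependence model, or equality of content model, over the set `U`: a union
set-assignment `s` together with a two-valued valuation `v`. -/
structure EModel (L : Dep) (X : Type w) (U : Type) where
  s : EFm X → Set U
  s_union : ∀ φ, s φ = ⋃ p ∈ φ.vars, s (.var p)
  v : EFm X → Bool
  v_neg : ∀ φ, v φ.neg = !v φ
  v_and : ∀ φ ψ, v (φ.and ψ) = (v φ && v ψ)
  v_or : ∀ φ ψ, v (φ.or ψ) = (v φ || v ψ)
  v_imp : ∀ φ ψ, L.Cond (s φ) (s ψ) → v (φ.imp ψ) = v (φ.neg.or ψ)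
  v_imp_of_not : ∀ φ ψ, ¬ L.Cond (s φ) (s ψ) → v (φ.imp ψ) = false

/-- Epstein's logic `L`: consequence over the class of its models on countable sets `U`. -/
def EEntails {X : Type w} (L : Dep) (Γ : Set (EFm X)) (φ : EFm X) : Prop :=
  ∀ (U : Type) [Countable U] (M : EModel L X U), (∀ γ ∈ Γ, M.v γ = true) → M.v φ = true

/-- The inclusion of the language `⟨¬, ∨, →⟩` into `⟨¬, ∧, ∨, →⟩`. -/
def Fm.toEFm {X : Type w} : Fm X → EFm X
  | .var p => .var p
  | .neg φ => .neg φ.toEFm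
  | .or φ ψ => .or φ.toEFm ψ.toEFm
  | .imp φ ψ => .imp φ.toEFm ψ.toEFm

/-- Reading `∧` as the abbreviation `¬(¬φ ∨ ¬ψ)`. -/
def EFm.unfold {X : Type w} : EFm X → Fm X
  | .var p => .var p
  | .neg φ => .neg φ.unfold
  | .and φ ψ => .and φ.unfold ψ.unfold
  | .or φ ψ => .or φ.unfold ψ.unfold
  | .imp φ ψ => .imp φ.unfold ψ.unfold

end EpsteinLogic

namespace EpsteinLogic

variable {X : Type w} {L : Dep}

/-! ### Soundness -/

/-! Soundness rests on `v_prec`: in every model the value of `φ ≺ ψ` is `⊤` or `⊥` according to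
whether the content of `φ` lies below that of `ψ`, so the content axioms become semilattice facts.
For completeness, a Lindenbaum argument puts an underivable formula outside some complete theory
`Δ`. There `≺` is a preorder that ignores `¬` and for which `∨` and `→` are joins. Sending `φ` to
the complement of its up-set `{χ | φ ≺ χ}` turns `≺` into inclusion and joins into unions, and A4
becomes the truth clause for `→`. This canonical model is two-valued with sets as contents, so the
same data refute the formula in both semantics. Conversely, an Epstein model restricts to a
`gL`-model, and soundness carries over. -/

open Classical in
/-- The truth value `⊤` or `⊥` of a proposition in a Boolean algebra. -/
noncomputable def truth (B : Type u) [BooleanAlgebra B] (p : Prop) : B := if p then ⊤ else ⊥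

section truth

variable {B : Type u} [BooleanAlgebra B] {p q : Prop}

theorem truth_of (h : p) : truth B p = ⊤ := if_pos h

theorem truth_of_not (h : ¬ p) : truth B p = ⊥ := if_neg h

theorem truth_mono (h : p → q) : truth B p ≤ truth B q := by
  by_cases hp : p
  · rw [truth_of hp, truth_of (h hp)]
  · rw [truth_of_not hp]
    exact bot_le

theorem truth_inf : truth B p ⊓ truth B q = truth B (p ∧ q) := by
  by_cases hp : p
  · rw [truth_of hp, top_inf_eq, and_iff_right hp]
  · rw [truth_of_not hp, bot_inf_eq, truth_of_not fun h => hp h.1]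

end truth

namespace GModel

variable {B : Type u} [BooleanAlgebra B] {S : Type v} [SemilatticeSup S] (M : GModel L X B S)

theorem v_imp_eq (φ ψ : Fm X) : M.v (φ.imp ψ) =
    ((M.v φ)ᶜ ⊔ M.v ψ) ⊓ truth B (L.Cond (M.s (N φ)) (M.s (N ψ))) := by
  by_cases h : L.Cond (M.s (N φ)) (M.s (N ψ))
  · rw [M.v_imp _ _ h, M.v_or, M.v_neg, truth_of h, inf_top_eq]
  · rw [M.v_imp_of_not _ _ h, truth_of_not h, inf_bot_eq]

theorem v_mat (φ ψ : Fm X) : M.v (φ.mat ψ) = (M.v φ)ᶜ ⊔ M.v ψ := by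
  rw [Fm.mat, M.v_or, M.v_neg]

theorem v_mat_eq_himp (φ ψ : Fm X) : M.v (φ.mat ψ) = M.v φ ⇨ M.v ψ := by
  rw [v_mat, himp_eq, sup_comm]

theorem v_and (φ ψ : Fm X) : M.v (φ.and ψ) = M.v φ ⊓ M.v ψ := by
  simp [Fm.and, M.v_or, M.v_neg]

theorem v_taut (φ : Fm X) : M.v φ.taut = ⊤ := by
  simp [Fm.taut, M.v_or, M.v_neg]

theorem v_iff_eq_top {φ ψ : Fm X} : M.v (φ.iff ψ) = ⊤ ↔ M.v φ = M.v ψ := by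
  rw [Fm.iff, v_and, v_mat_eq_himp, v_mat_eq_himp, inf_eq_top_iff, himp_eq_top_iff, himp_eq_top_iff, le_antisymm_iff]

theorem v_mat_eq_top {φ ψ : Fm X} : M.v (φ.mat ψ) = ⊤ ↔ M.v φ ≤ M.v ψ := by
  rw [v_mat_eq_himp, himp_eq_top_iff]

theorem s_N_neg (φ : Fm X) : M.s (N φ.neg) = M.s (N φ) := rfl

theorem s_N_or (φ ψ : Fm X) : M.s (N (φ.or ψ)) = M.s (N φ) ⊔ M.s (N ψ) := M.s_join _ _

theorem s_N_imp (φ ψ : Fm X) : M.s (N (φ.imp ψ)) = M.s (N φ) ⊔ M.s (N ψ) := M.s_join _ _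

theorem s_N_taut (φ : Fm X) : M.s (N φ.taut) = M.s (N φ) := by
  rw [Fm.taut, s_N_or, s_N_neg, sup_idem]

/-- The arrow that defines `≺` has a tautology as consequent, so only its content condition matters;
for `Eq` this is `a ⊔ b = b`, that is, `a ≤ b`. -/
theorem v_prec (φ ψ : Fm X) :
    M.v (φ.prec L ψ) = truth B (M.s (N φ) ≤ M.s (N ψ)) := by
  cases L <;> simp [Fm.prec, v_imp_eq, v_taut, s_N_taut, s_N_or, Dep.Cond]

theorem v_contentFm (φ ψ : Fm X) :
    M.v (contentFm L φ ψ) = truth B (L.Cond (M.s (N φ)) (M.s (N ψ))) := by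
  cases L
  · exact M.v_prec _ _
  · exact M.v_prec _ _
  · rw [contentFm, v_and, v_prec, v_prec, truth_inf, ← le_antisymm_iff, Dep.Cond]

theorem v_ax {φ : Fm X} (h : Ax L φ) : M.v φ = ⊤ := by
  cases h with
  | A0 φ ψ => rw [v_iff_eq_top, v_mat, M.v_or, M.v_neg, compl_compl]
  | A1 φ ψ =>
    rw [v_mat_eq_top, v_mat]
    exact le_sup_right
  | A2 φ ψ χ =>
    rw [v_mat_eq_top]
    simp only [v_mat_eq_himp]
    rw [le_himp_iff, ← himp_inf_distrib]
    exact himp_le_himp_left himp_inf_le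
  | A3 φ ψ =>
    rw [v_mat_eq_top, v_mat, v_mat, M.v_neg, M.v_neg, compl_compl, sup_comm]
  | A4 φ ψ => rw [v_iff_eq_top, v_and, v_contentFm, v_mat, v_imp_eq]
  | A5 φ ψ =>
    rw [v_and, v_prec, v_prec, truth_inf, s_N_imp, s_N_or]
    exact truth_of ⟨le_rfl, le_rfl⟩
  | O1 φ => exact (M.v_prec φ φ).trans (truth_of le_rfl)
  | O2 φ ψ χ =>
    rw [v_mat_eq_top, v_and, v_prec, v_prec, v_prec, truth_inf]
    exact truth_mono fun h => h.1.trans h.2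
  | O3 φ ψ =>
    rw [v_mat_eq_top, v_prec, v_prec, s_N_or]
    exact truth_mono fun h => sup_le h le_rfl
  | O4 φ ψ =>
    rw [v_and, inf_eq_top_iff, v_iff_eq_top, v_iff_eq_top]
    simp only [v_prec, s_N_neg, and_self]
  | C1 φ ψ =>
    rw [v_and, v_prec, v_prec, truth_inf, s_N_or]
    exact truth_of ⟨le_sup_left, le_sup_right⟩
  | C2 φ ψ χ =>
    rw [v_mat_eq_top, v_and, v_prec, v_prec, v_prec, truth_inf, s_N_or, sup_le_iff]
  | C3 φ ψ χ ζ =>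
    simp only [v_mat_eq_top, v_and, v_prec, truth_inf, s_N_imp]
    exact truth_mono fun h => sup_le_sup h.1.1.1 h.1.2

theorem v_derives {Γ : Set (Fm X)} {φ : Fm X} (hΓ : ∀ γ ∈ Γ, M.v γ = ⊤) (h : Derives L Γ φ) :
    M.v φ = ⊤ := by
  induction h with
  | hyp h => exact hΓ _ h
  | ax h => exact M.v_ax h
  | mp _ _ ih₁ ih₂ => exact top_le_iff.1 (ih₁ ▸ M.v_mat_eq_top.1 ih₂)

end GModel

/-! ### Derivations -/

namespace Derives

variable {Γ Δ : Set (Fm X)} {α β χ : Fm X}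

theorem mono (h : Γ ⊆ Δ) (d : Derives L Γ α) : Derives L Δ α := by
  induction d with
  | hyp h' => exact .hyp (h h')
  | ax h' => exact .ax h'
  | mp _ _ ih₁ ih₂ => exact .mp ih₁ ih₂

theorem mat_of (d : Derives L Γ β) : Derives L Γ (α.mat β) := .mp d (.ax (.A1 _ _))

theorem mat_mp (d₁ : Derives L Γ (α.mat (β.mat χ))) (d₂ : Derives L Γ (α.mat β)) :
    Derives L Γ (α.mat χ) := .mp d₂ (.mp d₁ (.ax (.A2 _ _ _)))

theorem mat_self : Derives L Γ (α.mat α) :=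
  mat_mp (.ax (.A1 α (α.mat α))) (.ax (.A1 α α))

/-- The deduction theorem. -/
theorem deduction (d : Derives L (insert α Γ) β) : Derives L Γ (α.mat β) := by
  induction d with
  | hyp h =>
    rcases h with rfl | h
    · exact mat_self
    · exact mat_of (.hyp h)
  | ax h => exact mat_of (.ax h)
  | mp _ _ ih₁ ih₂ => exact mat_mp ih₂ ih₁

theorem mat_trans (d₁ : Derives L Γ (α.mat β)) (d₂ : Derives L Γ (β.mat χ)) :
    Derives L Γ (α.mat χ) := mat_mp (mat_of d₂) d₁

theorem of_contra (d : Derives L Γ (α.neg.mat β.neg)) : Derives L Γ (β.mat α) :=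
  .mp d (.ax (.A3 _ _))

theorem explosion (d₁ : Derives L Γ α.neg) : Derives L Γ (α.mat β) := of_contra (mat_of d₁)

/-- Consequentia mirabilis. -/
theorem of_neg_mat_self (d : Derives L Γ (α.neg.mat α)) : Derives L Γ α := by
  -- Assuming `¬α`, the hypothesis gives `α`, hence everything, in particular the negation of `¬α ⊃
  -- α`; A3 contraposes this.
  have h : Derives L Γ (α.neg.mat (α.neg.mat α).neg) := by
    refine deduction ?_
    have h₁ : Derives L (insert α.neg Γ) α.neg := .hyp (Set.mem_insert _ _)
    exact .mp (.mp h₁ (d.mono (Set.subset_insert _ _))) (explosion h₁)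
  exact .mp d (of_contra h)

theorem neg_neg_elim : Derives L Γ (α.neg.neg.mat α) := by
  refine deduction (of_neg_mat_self ?_)
  exact explosion (.hyp (Set.mem_insert _ _))

theorem contra (d : Derives L Γ (α.mat β)) : Derives L Γ (β.neg.mat α.neg) :=
  of_contra (mat_trans (mat_trans neg_neg_elim d) (of_contra neg_neg_elim))

theorem cases (d₁ : Derives L Γ (α.mat χ)) (d₂ : Derives L Γ (α.neg.mat χ)) : Derives L Γ χ :=
  of_neg_mat_self (mat_trans (contra d₁) d₂)

/-- Derivations are finitary; this supplies the upper bounds of chains for Zorn's lemma. -/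
theorem exists_of_sUnion {c : Set (Set (Fm X))} (hc : IsChain (· ⊆ ·) c) (hne : c.Nonempty)
    (d : Derives L (⋃₀ c) α) : ∃ Γ ∈ c, Derives L Γ α := by
  induction d with
  | hyp h =>
    obtain ⟨Γ, hΓ, h⟩ := h
    exact ⟨Γ, hΓ, .hyp h⟩
  | ax h => exact hne.imp fun Γ hΓ => ⟨hΓ, .ax h⟩
  | mp _ _ ih₁ ih₂ =>
    obtain ⟨Γ₁, h₁, d₁⟩ := ih₁
    obtain ⟨Γ₂, h₂, d₂⟩ := ih₂
    rcases hc.total h₁ h₂ with h | h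
    · exact ⟨Γ₂, h₂, .mp (d₁.mono h) d₂⟩
    · exact ⟨Γ₁, h₁, .mp d₁ (d₂.mono h)⟩

end Derives

/-! ### Complete theories -/

/-- A set of formulae that is closed under derivations and decides every formula. -/
structure IsCompleteTheory (L : Dep) (Δ : Set (Fm X)) : Prop where
  closed : ∀ {α}, Derives L Δ α → α ∈ Δ
  neg_mem : ∀ {α : Fm X}, α.neg ∈ Δ ↔ α ∉ Δ

theorem exists_isCompleteTheory {Γ : Set (Fm X)} {φ : Fm X} (h : ¬ Derives L Γ φ) :
    ∃ Δ, Γ ⊆ Δ ∧ φ ∉ Δ ∧ IsCompleteTheory L Δ := by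
  obtain ⟨Δ, hΓ, hΔ⟩ := zorn_subset_nonempty {Δ | ¬ Derives L Δ φ}
    (fun c hc hchain hne => ⟨⋃₀ c, fun d => by
      obtain ⟨Γ', h₁, h₂⟩ := d.exists_of_sUnion hchain hne
      exact hc h₁ h₂, fun _ => Set.subset_sUnion_of_mem⟩) Γ h
  -- By maximality, adding `α` makes `φ` derivable; the deduction theorem applies.
  have hmat : ∀ {α}, α ∉ Δ → Derives L Δ (α.mat φ) := fun {α} hα => by
    by_contra hd
    exact hα (hΔ.le_of_ge (y := insert α Δ) (fun d => hd d.deduction) (Set.subset_insert _ _)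
      (Set.mem_insert _ _))
  have hclosed : ∀ {α}, Derives L Δ α → α ∈ Δ := fun {α} d => by
    by_contra hα
    exact hΔ.prop (d.mp (hmat hα))
  refine ⟨Δ, hΓ, fun h => hΔ.prop (.hyp h), hclosed, fun {α} => ⟨fun h₁ h₂ => ?_, fun h₁ => ?_⟩⟩
  · exact hΔ.prop (.mp (.hyp h₂) (.explosion (.hyp h₁)))
  · by_contra h₂
    exact hΔ.prop (.cases (hmat h₁) (hmat h₂))

namespace IsCompleteTheory

variable {Δ : Set (Fm X)} (h : IsCompleteTheory L Δ) {α β χ : Fm X}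
include h

theorem mat_mem : α.mat β ∈ Δ ↔ (α ∈ Δ → β ∈ Δ) := by
  refine ⟨fun h₁ h₂ => h.closed (.mp (.hyp h₂) (.hyp h₁)), fun h₁ => h.closed ?_⟩
  by_cases hα : α ∈ Δ
  · exact .mat_of (.hyp (h₁ hα))
  · exact .explosion (.hyp (h.neg_mem.2 hα))

theorem and_mem : α.and β ∈ Δ ↔ α ∈ Δ ∧ β ∈ Δ := by
  have h₁ : α.and β = (α.mat β.neg).neg := rfl
  rw [h₁, h.neg_mem, h.mat_mem, h.neg_mem]
  tauto

theorem iff_mem : α.iff β ∈ Δ ↔ (α ∈ Δ ↔ β ∈ Δ) := by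
  rw [Fm.iff, h.and_mem, h.mat_mem, h.mat_mem]
  tauto

theorem ax_mem (hα : Ax L α) : α ∈ Δ := h.closed (.ax hα)

theorem or_mem : α.or β ∈ Δ ↔ α ∈ Δ ∨ β ∈ Δ := by
  rw [h.iff_mem.1 (h.ax_mem (.A0 α β)), h.mat_mem, h.neg_mem]
  tauto

theorem prec_refl (α : Fm X) : α.prec L α ∈ Δ := h.ax_mem (.O1 α)

theorem prec_trans (h₁ : α.prec L β ∈ Δ) (h₂ : β.prec L χ ∈ Δ) : α.prec L χ ∈ Δ :=
  h.mat_mem.1 (h.ax_mem (.O2 α β χ)) (h.and_mem.2 ⟨h₁, h₂⟩)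

theorem neg_prec : α.neg.prec L χ ∈ Δ ↔ α.prec L χ ∈ Δ :=
  (h.iff_mem.1 (h.and_mem.1 (h.ax_mem (.O4 α χ))).2).symm

/-- C1 and C2 make the disjunction a least upper bound for `≺`. -/
theorem or_prec : (α.or β).prec L χ ∈ Δ ↔ α.prec L χ ∈ Δ ∧ β.prec L χ ∈ Δ := by
  have hC := h.and_mem.1 (h.ax_mem (.C1 α β))
  exact ⟨fun h₁ => ⟨h.prec_trans hC.1 h₁, h.prec_trans hC.2 h₁⟩,
    fun h₁ => h.mat_mem.1 (h.ax_mem (.C2 α β χ)) (h.and_mem.2 h₁)⟩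

theorem imp_prec : (α.imp β).prec L χ ∈ Δ ↔ α.prec L χ ∈ Δ ∧ β.prec L χ ∈ Δ := by
  have hA := h.and_mem.1 (h.ax_mem (.A5 α β))
  rw [← h.or_prec]
  exact ⟨h.prec_trans hA.2, h.prec_trans hA.1⟩

end IsCompleteTheory

/-! ### The canonical models -/

/-- The content of a formula in the canonical model of `Δ`: an order embedding of the
join-semilattice of contents into a power set, which turns joins into unions. -/
def content (L : Dep) (Δ : Set (Fm X)) [Small.{v} (Fm X)] (φ : Fm X) : Set (Shrink.{v} (Fm X)) :=
  {χ | φ.prec L ((equivShrink _).symm χ) ∉ Δ}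

namespace IsCompleteTheory

variable {Δ : Set (Fm X)} (h : IsCompleteTheory L Δ) [Small.{v} (Fm X)] {α β : Fm X}
include h

theorem content_neg : content.{v} L Δ α.neg = content L Δ α := by
  ext χ
  simp only [content, Set.mem_ofPred_eq, h.neg_prec]

theorem content_or : content.{v} L Δ (α.or β) = content L Δ α ∪ content L Δ β := by
  ext χ
  simp only [content, Set.mem_ofPred_eq, h.or_prec, Set.mem_union, not_and_or]

theorem content_imp : content.{v} L Δ (α.imp β) = content L Δ α ∪ content L Δ β := by
  ext χ
  simp only [content, Set.mem_ofPred_eq, h.imp_prec, Set.mem_union, not_and_or]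

theorem content_and : content.{v} L Δ (α.and β) = content L Δ α ∪ content L Δ β := by
  rw [Fm.and, h.content_neg, h.content_or, h.content_neg, h.content_neg]

/-- Yoneda for a preorder: transitivity gives one direction, testing at `β` itself the other. -/
theorem content_subset : content.{v} L Δ α ⊆ content L Δ β ↔ α.prec L β ∈ Δ := by
  refine ⟨fun h₁ => ?_, fun h₁ χ h₂ h₃ => h₂ (h.prec_trans h₁ h₃)⟩
  by_contra h₂
  refine h₁ (a := equivShrink _ β) ?_ ?_
  · simpa [content] using h₂
  · simpa using h.prec_refl β

theorem contentFm_mem :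
    contentFm L α β ∈ Δ ↔ L.Cond (content.{v} L Δ α) (content.{v} L Δ β) := by
  cases L
  · exact h.content_subset.symm
  · exact h.content_subset.symm
  · rw [contentFm, h.and_mem, ← h.content_subset, ← h.content_subset, Dep.Cond,
      Set.Subset.antisymm_iff]

theorem imp_mem : α.imp β ∈ Δ ↔
    (α ∈ Δ → β ∈ Δ) ∧ L.Cond (content.{v} L Δ α) (content.{v} L Δ β) := by
  rw [h.iff_mem.1 (h.ax_mem (.A4 α β)), h.and_mem, h.mat_mem, h.contentFm_mem]

end IsCompleteTheory

/-- The homomorphic extension of an assignment of contents to variables. -/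
def CTerm.lift {S : Type v} [SemilatticeSup S] (s : X → S) : CTerm X → S
  | .var p => s p
  | .join a b => a.lift s ⊔ b.lift s

theorem IsCompleteTheory.lift_N {Δ : Set (Fm X)} (h : IsCompleteTheory L Δ) [Small.{v} (Fm X)]
    (φ : Fm X) : (N φ).lift (fun p => content.{v} L Δ (.var p)) = content.{v} L Δ φ := by
  induction φ with
  | var p => rfl
  | neg φ ih => rw [h.content_neg, ← ih]; rfl
  | or φ ψ ih₁ ih₂ => rw [h.content_or, ← ih₁, ← ih₂]; rfl
  | imp φ ψ ih₁ ih₂ => rw [h.content_imp, ← ih₁, ← ih₂]; rfl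

/-- The canonical `gL`-model of a complete theory. -/
def canonicalGModel {Δ : Set (Fm X)} (h : IsCompleteTheory L Δ) [Small.{v} (Fm X)] :
    GModel L X (Set PUnit.{u + 1}) (Set (Shrink.{v} (Fm X))) where
  s := CTerm.lift fun p => content L Δ (.var p)
  s_join _ _ := rfl
  -- The power set of a point is the two-element Boolean algebra, placed in universe `u`.
  v φ := {_x | φ ∈ Δ}
  v_neg φ := by ext; simp [h.neg_mem]
  v_or φ ψ := by ext; simp [h.or_mem]
  v_imp φ ψ hC := by
    rw [h.lift_N, h.lift_N] at hC
    ext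
    simp [h.imp_mem, hC, h.or_mem, h.neg_mem, imp_iff_not_or]
  v_imp_of_not φ ψ hC := by
    rw [h.lift_N, h.lift_N] at hC
    ext
    simp [h.imp_mem, hC]

open Classical in
/-- The canonical Epstein model of a complete theory. -/
noncomputable def canonicalEModel {Δ : Set (Fm X)} (h : IsCompleteTheory L Δ)
    [Small.{0} (Fm X)] : EModel L X (Shrink.{0} (Fm X)) where
  s φ := content L Δ φ.unfold
  s_union φ := by
    induction φ with
    | var p => simp [EFm.vars]
    | neg φ ih => rw [EFm.unfold, h.content_neg, ih]; rfl
    | and φ ψ ih₁ ih₂ => rw [EFm.unfold, h.content_and, ih₁, ih₂, EFm.vars, Set.biUnion_union]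
    | or φ ψ ih₁ ih₂ => rw [EFm.unfold, h.content_or, ih₁, ih₂, EFm.vars, Set.biUnion_union]
    | imp φ ψ ih₁ ih₂ => rw [EFm.unfold, h.content_imp, ih₁, ih₂, EFm.vars, Set.biUnion_union]
  v φ := decide (φ.unfold ∈ Δ)
  v_neg φ := by simp [EFm.unfold, h.neg_mem]
  v_and φ ψ := by simp [EFm.unfold, h.and_mem]
  v_or φ ψ := by simp [EFm.unfold, h.or_mem]
  v_imp φ ψ hC := by simp [EFm.unfold, h.imp_mem, hC, h.or_mem, h.neg_mem, imp_iff_not_or]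
  v_imp_of_not φ ψ hC := by simp [EFm.unfold, h.imp_mem, hC]

/-! ### Countability of the language -/

/-- A numbering of the formulae induced by a numbering of the variables. -/
def Fm.code (e : X → ℕ) : Fm X → ℕ
  | .var p => Nat.pair 0 (e p)
  | .neg φ => Nat.pair 1 (φ.code e)
  | .or φ ψ => Nat.pair 2 (Nat.pair (φ.code e) (ψ.code e))
  | .imp φ ψ => Nat.pair 3 (Nat.pair (φ.code e) (ψ.code e))

theorem Fm.code_injective {e : X → ℕ} (he : Function.Injective e) :
    Function.Injective (Fm.code e) := by
  intro φ
  induction φ with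
  | var p => intro ψ h; cases ψ <;> simp_all [Fm.code, Nat.pair_eq_pair, he.eq_iff]
  | neg φ ih =>
    intro ψ h
    cases ψ <;> simp [Fm.code, Nat.pair_eq_pair] at h
    rw [ih h]
  | or φ₁ φ₂ ih₁ ih₂ =>
    intro ψ h
    cases ψ <;> simp [Fm.code, Nat.pair_eq_pair] at h
    rw [ih₁ h.1, ih₂ h.2]
  | imp φ₁ φ₂ ih₁ ih₂ =>
    intro ψ h
    cases ψ <;> simp [Fm.code, Nat.pair_eq_pair] at h
    rw [ih₁ h.1, ih₂ h.2]

/-- Countability makes `Fm X` small in every universe, so contents fit any required level, and it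
makes the canonical Epstein model's underlying set countable. -/
instance [Countable X] : Countable (Fm X) :=
  let ⟨_, he⟩ := exists_injective_nat X
  (Fm.code_injective he).countable

/-! ### Epstein models as `gL`-models -/

namespace EModel

variable {U : Type} (M : EModel L X U)

theorem s_neg (φ : EFm X) : M.s φ.neg = M.s φ := by
  rw [M.s_union, M.s_union φ]; rfl

theorem s_and (φ ψ : EFm X) : M.s (φ.and ψ) = M.s φ ∪ M.s ψ := by
  rw [M.s_union, M.s_union φ, M.s_union ψ, EFm.vars, Set.biUnion_union]

theorem s_or (φ ψ : EFm X) : M.s (φ.or ψ) = M.s φ ∪ M.s ψ := by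
  rw [M.s_union, M.s_union φ, M.s_union ψ, EFm.vars, Set.biUnion_union]

theorem s_imp (φ ψ : EFm X) : M.s (φ.imp ψ) = M.s φ ∪ M.s ψ := by
  rw [M.s_union, M.s_union φ, M.s_union ψ, EFm.vars, Set.biUnion_union]

theorem lift_N (φ : Fm X) : (N φ).lift (fun p => M.s (.var p)) = M.s φ.toEFm := by
  induction φ with
  | var p => rfl
  | neg φ ih => rw [Fm.toEFm, s_neg, ← ih]; rfl
  | or φ ψ ih₁ ih₂ => rw [Fm.toEFm, s_or, ← ih₁, ← ih₂]; rfl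
  | imp φ ψ ih₁ ih₂ => rw [Fm.toEFm, s_imp, ← ih₁, ← ih₂]; rfl

theorem s_unfold (φ : EFm X) : M.s φ.unfold.toEFm = M.s φ := by
  induction φ with
  | var p => rfl
  | neg φ ih => rw [EFm.unfold, Fm.toEFm, s_neg, s_neg, ih]
  | and φ ψ ih₁ ih₂ => simp only [EFm.unfold, Fm.and, Fm.toEFm, s_neg, s_or, s_and, ih₁, ih₂]
  | or φ ψ ih₁ ih₂ => rw [EFm.unfold, Fm.toEFm, s_or, s_or, ih₁, ih₂]
  | imp φ ψ ih₁ ih₂ => rw [EFm.unfold, Fm.toEFm, s_imp, s_imp, ih₁, ih₂]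

/-- De Morgan handles `∧`; the case of `→` also needs unfolding to preserve contents. -/
theorem v_unfold (φ : EFm X) : M.v φ.unfold.toEFm = M.v φ := by
  induction φ with
  | var p => rfl
  | neg φ ih => rw [EFm.unfold, Fm.toEFm, v_neg, v_neg, ih]
  | and φ ψ ih₁ ih₂ => simp [EFm.unfold, Fm.and, Fm.toEFm, v_neg, v_or, v_and, ih₁, ih₂]
  | or φ ψ ih₁ ih₂ => rw [EFm.unfold, Fm.toEFm, v_or, v_or, ih₁, ih₂]
  | imp φ ψ ih₁ ih₂ =>
    rw [EFm.unfold, Fm.toEFm]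
    by_cases hC : L.Cond (M.s φ) (M.s ψ)
    · rw [M.v_imp _ _ hC, M.v_imp _ _ (by rwa [s_unfold, s_unfold]), v_or, v_or, v_neg, v_neg,
        ih₁, ih₂]
    · rw [M.v_imp_of_not _ _ hC, M.v_imp_of_not _ _ (by rwa [s_unfold, s_unfold])]

/-- The `gL`-model given by the restriction of an Epstein model to the language `⟨¬, ∨, →⟩`. -/
def toGModel : GModel L X Bool (Set U) where
  s := CTerm.lift fun p => M.s (.var p)
  s_join _ _ := rfl
  v φ := M.v φ.toEFm
  v_neg φ := M.v_neg _
  v_or φ ψ := M.v_or _ _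
  v_imp φ ψ hC := M.v_imp _ _ (by rwa [lift_N, lift_N] at hC)
  v_imp_of_not φ ψ hC := M.v_imp_of_not _ _ (by rwa [lift_N, lift_N] at hC)

end EModel

theorem Fm.unfold_toEFm (φ : Fm X) : φ.toEFm.unfold = φ := by
  induction φ with
  | var p => rfl
  | neg φ ih => rw [Fm.toEFm, EFm.unfold, ih]
  | or φ ψ ih₁ ih₂ => rw [Fm.toEFm, EFm.unfold, ih₁, ih₂]
  | imp φ ψ ih₁ ih₂ => rw [Fm.toEFm, EFm.unfold, ih₁, ih₂]

/-! ### Soundness and completeness -/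

theorem derives_iff_gEntails [Countable X] (Γ : Set (Fm X)) (φ : Fm X) :
    Derives L Γ φ ↔ GEntails.{u, v, w} L Γ φ := by
  refine ⟨fun d B _ S _ M hΓ => M.v_derives hΓ d, fun h => ?_⟩
  by_contra hd
  obtain ⟨Δ, hΓ, hφ, hΔ⟩ := exists_isCompleteTheory hd
  have h₁ := h _ _ (canonicalGModel.{u, v, w} hΔ) fun γ hγ => Set.eq_univ_of_forall fun _ => hΓ hγ
  exact hφ (Set.eq_univ_iff_forall.1 h₁ PUnit.unit)

theorem eEntails_iff_derives [Countable X] (Γ : Set (EFm X)) (φ : EFm X) :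
    EEntails L Γ φ ↔ Derives L (EFm.unfold '' Γ) φ.unfold := by
  refine ⟨fun h => ?_, fun d U _ M hΓ => ?_⟩
  · classical
    by_contra hd
    obtain ⟨Δ, hΓ, hφ, hΔ⟩ := exists_isCompleteTheory hd
    have : Countable (Shrink.{0} (Fm X)) := (equivShrink.{0} (Fm X)).symm.injective.countable
    exact hφ (decide_eq_true_iff.1 (h _ (canonicalEModel hΔ) fun γ hγ =>
      decide_eq_true_iff.2 (hΓ (Set.mem_image_of_mem _ hγ))))
  · rw [← M.v_unfold]
    refine M.toGModel.v_derives ?_ d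
    rintro _ ⟨γ, hγ, rfl⟩
    exact (M.v_unfold γ).trans (hΓ γ hγ)

end EpsteinLogic

theorem mainTheorem9 (X : Type w) [Countable X] (L : EpsteinLogic.Dep) :
    -- strong completeness of `gL` with respect to `gL`-models
    (∀ (Γ : Set (EpsteinLogic.Fm X)) (φ : EpsteinLogic.Fm X),
      EpsteinLogic.Derives L Γ φ ↔ EpsteinLogic.GEntails.{u, v, w} L Γ φ) ∧
    -- `L` and `gL` are the same logic on the language `⟨¬, ∨, →⟩` of the calculus
    (∀ (Γ : Set (EpsteinLogic.Fm X)) (φ : EpsteinLogic.Fm X),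
      EpsteinLogic.EEntails L (EpsteinLogic.Fm.toEFm '' Γ) φ.toEFm ↔
        EpsteinLogic.Derives L Γ φ) ∧
    -- and on `⟨¬, ∧, ∨, →⟩`, when conjunction is read as an abbreviation in `gL`
    (∀ (Γ : Set (EpsteinLogic.EFm X)) (φ : EpsteinLogic.EFm X),
      EpsteinLogic.EEntails L Γ φ ↔
        EpsteinLogic.Derives L (EpsteinLogic.EFm.unfold '' Γ) φ.unfold) := by
  refine ⟨EpsteinLogic.derives_iff_gEntails, fun Γ φ => ?_, EpsteinLogic.eEntails_iff_derives⟩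
  -- The third claim specializes to the second, since unfolding does nothing to conjunction-free
  -- formulae.
  rw [EpsteinLogic.eEntails_iff_derives, Set.image_image]
  simp only [EpsteinLogic.Fm.unfold_toEFm, Set.image_id']
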